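/- For a positive integer $n$, let $\|n\|$ denote the complexity of $n$: the least number of $1$'s needed to write $n$ as an expression using only the constant $1$, addition and multiplication (with parentheses placed arbitrarily). Let $\delta(n)=\|n\|-3\log_3 n$ be the defect of $n$, and let $\mathscr{D}=\{\delta(n): n\ge 1\ \text{an integer}\}\subseteq\mathbb{R}$ be the set of all defects. Write $\overline{\mathscr{D}}$ for the closure of $\mathscr{D}$ in $\mathbb{R}$, and $S'$ for the set of limit points in $\mathbb{R}$ of a set $S\subseteq\mathbb{R}$. Then $$\overline{\mathscr{D}}' = \overline{\mathscr{D}}+1 = \{x+1 : x\in\overline{\mathscr{D}}\}.$$ -/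

import Mathlib

/-- Expressions built from the constant `1` by binary addition and multiplication. -/
inductive OneExpr : Type where
  | one : OneExpr
  | add : OneExpr → OneExpr → OneExpr
  | mul : OneExpr → OneExpr → OneExpr

namespace OneExpr

/-- The natural number that an expression evaluates to. -/
def val : OneExpr → ℕ
  | one => 1
  | add a b => a.val + b.val
  | mul a b => a.val * b.val

/-- The number of `1`'s used in an expression. -/
def ones : OneExpr → ℕ
  | one => 1
  | add a b => a.ones + b.ones
  | mul a b => a.ones + b.ones

/-- Every positive integer is the value of some expression. -/
theorem exists_val_eq (n : ℕ) (hn : 0 < n) : ∃ e : OneExpr, e.val = n := by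
  induction n, hn using Nat.le_induction with
  | base => exact ⟨one, rfl⟩
  | succ m _ ih =>
    obtain ⟨e, he⟩ := ih
    exact ⟨add e one, by simp [val, he]⟩

end OneExpr

/-- The integer complexity of `n`: the least number of `1`'s in an expression with value `n`.
It is only used for `n ≥ 1`, where such expressions exist. -/
noncomputable def integerComplexity (n : ℕ) : ℕ :=
  sInf {k : ℕ | ∃ e : OneExpr, e.val = n ∧ e.ones = k}

/-- For `n ≥ 1` the infimum in the definition of the complexity is attained. -/
theorem exists_ones_eq_integerComplexity (n : ℕ) (hn : 0 < n) :
    ∃ e : OneExpr, e.val = n ∧ e.ones = integerComplexity n := by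
  obtain ⟨e, he⟩ := OneExpr.exists_val_eq n hn
  exact Nat.sInf_mem (s := {k : ℕ | ∃ e : OneExpr, e.val = n ∧ e.ones = k}) ⟨_, e, he, rfl⟩

/-- The defect of `n`: its complexity minus `3 log₃ n`. -/
noncomputable def defect (n : ℕ) : ℝ :=
  (integerComplexity n : ℝ) - 3 * Real.logb 3 (n : ℝ)

/-- The set of all defects of positive integers. -/
def defectSet : Set ℝ :=
  {x : ℝ | ∃ n : ℕ, 0 < n ∧ defect n = x}

open Filter Topology

/-! Both inclusions rest on `LimitDescent K`, proved for `K` in steps of the least nonzero defect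
(`LimitDescent.add_gap`). An optimal expression is a sum or a product, so a new limit point arises
from one of these. For sums `a + b`, the complexity of `b` stays bounded while `a` grows, so the
limit is a limit of defects plus ‖b‖ ≥ 1. For products it is `α + β` with `α` a limit point and `β`
at least the gap; the hypothesis applies to `α`, and below `K` the closure is stable under addition.
Conversely, if multiplying `n` by powers of 3 never changes its defect, the defects of `3 ^ k * n +
1` tend to `defect n + 1` up to an integer drop. Descent turns a positive drop into a defect lying a
positive integer below `defect n`, contradicting stability. Every defect is a stable one plus a
natural number, so this carries over to the closure. -/

/-! ### Bounds on complexity -/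

theorem add_one_cube_le {a m : ℕ} (ha : 0 < a) (hm : 0 < m) (h : a ^ 3 ≤ 3 ^ m) :
    (a + 1) ^ 3 ≤ 3 ^ (m + 1) := by
  rcases (by omega : a = 1 ∨ a = 2 ∨ 3 ≤ a) with rfl | rfl | h3
  · calc (1 + 1) ^ 3 ≤ 3 ^ 2 := by norm_num
      _ ≤ 3 ^ (m + 1) := Nat.pow_le_pow_right (by norm_num) (by omega)
  · have : 2 ≤ m := by
      by_contra hlt
      obtain rfl : m = 1 := by omega
      norm_num at h
    calc (2 + 1) ^ 3 = 3 ^ 3 := by norm_num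
      _ ≤ 3 ^ (m + 1) := Nat.pow_le_pow_right (by norm_num) (by omega)
  -- `(a + 1) ^ 3 ≤ 3 * a ^ 3` holds only from `a = 3` on.
  · obtain ⟨k, rfl⟩ := Nat.exists_eq_add_of_le h3
    rw [pow_succ 3 m]
    refine le_trans ?_ (Nat.mul_le_mul_right 3 h)
    nlinarith [Nat.zero_le (k ^ 3), Nat.zero_le (k ^ 2)]

namespace OneExpr

theorem val_pos (e : OneExpr) : 0 < e.val := by
  induction e with
  | one => exact Nat.one_pos
  | add a b iha ihb => simp only [val]; omega
  | mul a b iha ihb => exact Nat.mul_pos iha ihb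

theorem ones_pos (e : OneExpr) : 0 < e.ones := by
  induction e with
  | one => exact Nat.one_pos
  | add a b iha ihb => simp only [ones]; omega
  | mul a b iha ihb => simp only [ones]; omega

theorem integerComplexity_val_le (e : OneExpr) : integerComplexity e.val ≤ e.ones :=
  Nat.sInf_le ⟨e, rfl, rfl⟩

theorem val_cube_le (e : OneExpr) : e.val ^ 3 ≤ 3 ^ e.ones := by
  induction e with
  | one => norm_num [val, ones]
  | add a b iha ihb =>
    simp only [val, ones]
    rcases Nat.lt_or_ge 1 a.val with ha | ha
    · rcases Nat.lt_or_ge 1 b.val with hb | hb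
      · calc (a.val + b.val) ^ 3 ≤ (a.val * b.val) ^ 3 :=
              Nat.pow_le_pow_left (by nlinarith) 3
          _ = a.val ^ 3 * b.val ^ 3 := mul_pow _ _ _
          _ ≤ 3 ^ (a.ones + b.ones) := by rw [pow_add]; exact Nat.mul_le_mul iha ihb
      · rw [show b.val = 1 from le_antisymm hb b.val_pos]
        exact (add_one_cube_le a.val_pos a.ones_pos iha).trans
          (Nat.pow_le_pow_right (by norm_num) (by have := b.ones_pos; omega))
    · rw [show a.val = 1 from le_antisymm ha a.val_pos, add_comm 1, add_comm a.ones]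
      exact (add_one_cube_le b.val_pos b.ones_pos ihb).trans
        (Nat.pow_le_pow_right (by norm_num) (by have := a.ones_pos; omega))
  | mul a b iha ihb =>
    simp only [val, ones]
    rw [mul_pow, pow_add]
    exact Nat.mul_le_mul iha ihb

end OneExpr

theorem integerComplexity_pos {n : ℕ} (hn : 0 < n) : 0 < integerComplexity n := by
  obtain ⟨e, -, he⟩ := exists_ones_eq_integerComplexity n hn
  exact he ▸ e.ones_pos

theorem integerComplexity_one : integerComplexity 1 = 1 :=
  le_antisymm OneExpr.one.integerComplexity_val_le (integerComplexity_pos Nat.one_pos)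

theorem integerComplexity_add_le {a b : ℕ} (ha : 0 < a) (hb : 0 < b) :
    integerComplexity (a + b) ≤ integerComplexity a + integerComplexity b := by
  obtain ⟨e, rfl, he⟩ := exists_ones_eq_integerComplexity a ha
  obtain ⟨f, rfl, hf⟩ := exists_ones_eq_integerComplexity b hb
  rw [← he, ← hf]
  exact (OneExpr.add e f).integerComplexity_val_le

theorem integerComplexity_mul_le {a b : ℕ} (ha : 0 < a) (hb : 0 < b) :
    integerComplexity (a * b) ≤ integerComplexity a + integerComplexity b := by
  obtain ⟨e, rfl, he⟩ := exists_ones_eq_integerComplexity a ha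
  obtain ⟨f, rfl, hf⟩ := exists_ones_eq_integerComplexity b hb
  rw [← he, ← hf]
  exact (OneExpr.mul e f).integerComplexity_val_le

theorem cube_le_three_pow_integerComplexity {n : ℕ} (hn : 0 < n) :
    n ^ 3 ≤ 3 ^ integerComplexity n := by
  obtain ⟨e, rfl, he⟩ := exists_ones_eq_integerComplexity n hn
  exact he ▸ e.val_cube_le

/-- An optimal expression of `n` is `1`, an optimal sum or an optimal product. -/
theorem integerComplexity_cases {n : ℕ} (hn : 0 < n) : n = 1 ∨
    (∃ a b, 0 < b ∧ b ≤ a ∧ n = a + b ∧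
      integerComplexity n = integerComplexity a + integerComplexity b) ∨
    (∃ a b, 0 < a ∧ 0 < b ∧ n = a * b ∧
      integerComplexity n = integerComplexity a + integerComplexity b) := by
  obtain ⟨e, rfl, he⟩ := exists_ones_eq_integerComplexity n hn
  cases e with
  | one => exact Or.inl rfl
  | add a b =>
    have h := integerComplexity_add_le a.val_pos b.val_pos
    have ha := a.integerComplexity_val_le
    have hb := b.integerComplexity_val_le
    simp only [OneExpr.val, OneExpr.ones] at he ⊢
    refine Or.inr (Or.inl ?_)
    rcases le_total b.val a.val with hab | hab
    · exact ⟨a.val, b.val, b.val_pos, hab, rfl, by omega⟩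
    · exact ⟨b.val, a.val, a.val_pos, hab, add_comm _ _, by omega⟩
  | mul a b =>
    have h := integerComplexity_mul_le a.val_pos b.val_pos
    have ha := a.integerComplexity_val_le
    have hb := b.integerComplexity_val_le
    simp only [OneExpr.val, OneExpr.ones] at he ⊢
    exact Or.inr (Or.inr ⟨a.val, b.val, a.val_pos, b.val_pos, rfl, by omega⟩)

/-! ### Defects of sums and products -/

theorem defect_mem_defectSet {n : ℕ} (hn : 0 < n) : defect n ∈ defectSet := ⟨n, hn, rfl⟩

theorem three_mul_logb_le {x : ℝ} {k : ℕ} (hx : 0 < x) (h : x ^ 3 ≤ 3 ^ k) :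
    3 * Real.logb 3 x ≤ k := by
  have := Real.logb_le_logb_of_le (b := 3) (by norm_num) (by positivity) h
  rw [Real.logb_pow, Real.logb_pow, Real.logb_self_eq_one (by norm_num)] at this
  simpa using this

theorem defect_nonneg {n : ℕ} (hn : 0 < n) : 0 ≤ defect n :=
  sub_nonneg.2 (three_mul_logb_le (by exact_mod_cast hn)
    (by exact_mod_cast cube_le_three_pow_integerComplexity hn))

theorem defect_one : defect 1 = 1 := by
  simp [defect, integerComplexity_one]

theorem defect_mul_of_eq {a b : ℕ} (ha : 0 < a) (hb : 0 < b)
    (h : integerComplexity (a * b) = integerComplexity a + integerComplexity b) :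
    defect (a * b) = defect a + defect b := by
  have ha' : (a : ℝ) ≠ 0 := by positivity
  have hb' : (b : ℝ) ≠ 0 := by positivity
  rw [defect, defect, defect, h, Nat.cast_mul, Real.logb_mul ha' hb']
  push_cast; ring

theorem exists_defect_mul_add {a b : ℕ} (ha : 0 < a) (hb : 0 < b) :
    ∃ j : ℕ, defect (a * b) + j = defect a + defect b := by
  have ha' : (a : ℝ) ≠ 0 := by positivity
  have hb' : (b : ℝ) ≠ 0 := by positivity
  obtain ⟨j, hj⟩ := Nat.exists_eq_add_of_le (integerComplexity_mul_le ha hb)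
  refine ⟨j, ?_⟩
  have hj' : (integerComplexity a : ℝ) + integerComplexity b = integerComplexity (a * b) + j := by
    exact_mod_cast hj
  rw [defect, defect, defect, Nat.cast_mul, Real.logb_mul ha' hb']
  linarith

theorem logb_add_eq {a b : ℕ} (ha : 0 < a) :
    Real.logb 3 ((a + b : ℕ) : ℝ) = Real.logb 3 a + Real.logb 3 (1 + b / a) := by
  have ha' : (a : ℝ) ≠ 0 := by positivity
  rw [← Real.logb_mul ha' (by positivity)]
  congr 1
  push_cast
  field_simp

theorem defect_add_of_eq {a b : ℕ} (ha : 0 < a)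
    (h : integerComplexity (a + b) = integerComplexity a + integerComplexity b) :
    defect (a + b) = defect a + integerComplexity b - 3 * Real.logb 3 (1 + b / a) := by
  rw [defect, defect, h, logb_add_eq ha]
  push_cast; ring

theorem exists_defect_add_one {a : ℕ} (ha : 0 < a) :
    ∃ j : ℕ, defect (a + 1) + j = defect a + 1 - 3 * Real.logb 3 (1 + 1 / a) := by
  obtain ⟨j, hj⟩ := Nat.exists_eq_add_of_le (integerComplexity_add_le ha Nat.one_pos)
  refine ⟨j, ?_⟩
  rw [integerComplexity_one] at hj
  have hj' : (integerComplexity a : ℝ) + 1 = integerComplexity (a + 1) + j := by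
    exact_mod_cast hj
  rw [defect, defect, logb_add_eq ha, Nat.cast_one]
  linarith

theorem defect_three : defect 3 = 0 := by
  refine le_antisymm ?_ (defect_nonneg (by norm_num))
  have h2 := integerComplexity_add_le (a := 1) (b := 1) (by norm_num) (by norm_num)
  have h3 := integerComplexity_add_le (a := 2) (b := 1) (by norm_num) (by norm_num)
  rw [integerComplexity_one] at h2 h3
  change integerComplexity 2 ≤ 1 + 1 at h2
  change integerComplexity 3 ≤ integerComplexity 2 + 1 at h3
  have : (integerComplexity 3 : ℝ) ≤ 3 := by exact_mod_cast h3.trans (by omega)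
  have hl : Real.logb 3 ((3 : ℕ) : ℝ) = 1 := by
    rw [Nat.cast_ofNat]; exact Real.logb_self_eq_one (by norm_num)
  rw [defect, hl]
  linarith

/-! ### The gap above zero -/

/-- The least nonzero defect, which is the defect of `2`. -/
noncomputable def defectGap : ℝ := 2 - 3 * Real.logb 3 2

theorem defectGap_pos : 0 < defectGap := by
  have : Real.logb 3 ((2 : ℝ) ^ 3) < Real.logb 3 (3 ^ 2) :=
    Real.logb_lt_logb (by norm_num) (by norm_num) (by norm_num)
  rw [Real.logb_pow, Real.logb_pow, Real.logb_self_eq_one (by norm_num)] at this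
  rw [defectGap]
  push_cast at this
  linarith

theorem defectGap_le_one : defectGap ≤ 1 := by
  have : Real.logb 3 (3 ^ 1 : ℝ) ≤ Real.logb 3 (2 ^ 3) :=
    Real.logb_le_logb_of_le (by norm_num) (by norm_num) (by norm_num)
  rw [Real.logb_pow, Real.logb_pow, Real.logb_self_eq_one (by norm_num)] at this
  rw [defectGap]
  push_cast at this
  linarith

theorem logb_one_add_div_le {a b : ℕ} (ha : 0 < a) (hba : b ≤ a) :
    Real.logb 3 (1 + b / a) ≤ Real.logb 3 2 := by
  have ha' : (0 : ℝ) < a := by positivity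
  have : (b : ℝ) / a ≤ 1 := (div_le_one ha').2 (by exact_mod_cast hba)
  exact Real.logb_le_logb_of_le (by norm_num) (by positivity) (by linarith)

theorem defect_add_eq_zero_or_ge {a b : ℕ} (hb : 0 < b) (hba : b ≤ a)
    (h : integerComplexity (a + b) = integerComplexity a + integerComplexity b) :
    defect (a + b) = 0 ∨ defectGap ≤ defect (a + b) := by
  have ha : 0 < a := hb.trans_le hba
  have hd := defect_add_of_eq ha h
  have hl := logb_one_add_div_le ha hba
  have hnn := defect_nonneg ha
  have hpos := integerComplexity_pos hb
  rcases (by omega : integerComplexity b = 1 ∨ 2 ≤ integerComplexity b) with h1 | h2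
  · have hb1 : b = 1 := by
      have := cube_le_three_pow_integerComplexity hb
      rw [h1] at this
      by_contra hne
      have : 2 ^ 3 ≤ b ^ 3 := Nat.pow_le_pow_left (by omega) 3
      omega
    subst hb1
    rcases (by omega : a = 1 ∨ a = 2 ∨ 3 ≤ a) with rfl | rfl | h3
    · right
      rw [defect_one, h1, Nat.cast_one] at hd
      rw [defectGap, hd]
      norm_num
    · exact Or.inl defect_three
    · right
      have h3' : (3 : ℝ) ≤ a := by exact_mod_cast h3
      have h43 : Real.logb 3 (1 + ((1 : ℕ) : ℝ) / a) ≤ Real.logb 3 (4 / 3) := by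
        refine Real.logb_le_logb_of_le (by norm_num) (by positivity) ?_
        have : ((1 : ℕ) : ℝ) / a ≤ 1 / 3 := by
          rw [Nat.cast_one]
          exact one_div_le_one_div_of_le (by norm_num) h3'
        linarith
      -- Equivalent to `27 / 8 ≥ 3`; it gives `1 - 3 log₃ (4/3) ≥ 2 - 3 log₃ 2`.
      have h32 : (1 : ℝ) ≤ 3 * Real.logb 3 (3 / 2) := by
        have : Real.logb 3 (3 ^ 1 : ℝ) ≤ Real.logb 3 ((3 / 2) ^ 3) :=
          Real.logb_le_logb_of_le (by norm_num) (by norm_num) (by norm_num)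
        rw [Real.logb_pow, Real.logb_pow, Real.logb_self_eq_one (by norm_num)] at this
        push_cast at this
        linarith
      have hmul : Real.logb 3 2 = Real.logb 3 (4 / 3) + Real.logb 3 (3 / 2) := by
        rw [← Real.logb_mul (by norm_num) (by norm_num)]
        norm_num
      rw [h1, Nat.cast_one] at hd
      rw [defectGap]
      push_cast at *
      linarith
  · right
    have : (2 : ℝ) ≤ integerComplexity b := by exact_mod_cast h2
    rw [defectGap]
    linarith

theorem one_lt_factors {a b : ℕ} (ha : 0 < a) (hb : 0 < b)
    (h : integerComplexity (a * b) = integerComplexity a + integerComplexity b) :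
    1 < a ∧ 1 < b := by
  have hpa := integerComplexity_pos ha
  have hpb := integerComplexity_pos hb
  constructor
  · by_contra hlt
    obtain rfl : a = 1 := by omega
    rw [one_mul] at h
    omega
  · by_contra hlt
    obtain rfl : b = 1 := by omega
    rw [mul_one] at h
    omega

theorem defect_eq_zero_or_ge {n : ℕ} (hn : 0 < n) : defect n = 0 ∨ defectGap ≤ defect n := by
  induction n using Nat.strong_induction_on with
  | _ n ih =>
    rcases integerComplexity_cases hn with rfl | ⟨a, b, hb, hba, rfl, h⟩ | ⟨a, b, ha, hb, rfl, h⟩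
    · exact Or.inr (defect_one ▸ defectGap_le_one)
    · exact defect_add_eq_zero_or_ge hb hba h
    · obtain ⟨ha1, hb1⟩ := one_lt_factors ha hb h
      rw [defect_mul_of_eq ha hb h]
      have hna := defect_nonneg ha
      have hnb := defect_nonneg hb
      rcases ih a (by nlinarith) ha with h0 | h0
      · rcases ih b (by nlinarith) hb with h1 | h1
        · exact Or.inl (by rw [h0, h1, add_zero])
        · exact Or.inr (by linarith)
      · exact Or.inr (by linarith)

/-- The defects of sums `a + b`, `b ≤ a`, whose complexity is the sum of those of `a` and `b`. -/
def sumDefectSet : Set ℝ :=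
  {x | ∃ a b : ℕ, 0 < b ∧ b ≤ a ∧
    integerComplexity (a + b) = integerComplexity a + integerComplexity b ∧ defect (a + b) = x}

/-- The sums of two nonzero defects. -/
def productDefectSet : Set ℝ :=
  {x | ∃ u ∈ defectSet, ∃ v ∈ defectSet, defectGap ≤ u ∧ defectGap ≤ v ∧ u + v = x}

/-- A factor of defect zero can be dropped from an optimal product, so induction on `n` leaves only
products of two factors of nonzero defect. -/
theorem defectSet_subset : defectSet ⊆ {0, 1} ∪ (sumDefectSet ∪ productDefectSet) := by
  rintro x ⟨n, hn, rfl⟩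
  induction n using Nat.strong_induction_on with
  | _ n ih =>
    rcases integerComplexity_cases hn with rfl | ⟨a, b, hb, hba, rfl, h⟩ | ⟨a, b, ha, hb, rfl, h⟩
    · exact Or.inl (Or.inr defect_one)
    · exact Or.inr (Or.inl ⟨a, b, hb, hba, h, rfl⟩)
    · obtain ⟨ha1, hb1⟩ := one_lt_factors ha hb h
      rw [defect_mul_of_eq ha hb h]
      rcases defect_eq_zero_or_ge ha with h0 | h0
      · rw [h0, zero_add]
        exact ih b (by nlinarith) hb
      · rcases defect_eq_zero_or_ge hb with h1 | h1
        · rw [h1, add_zero]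
          exact ih a (by nlinarith) ha
        · exact Or.inr (Or.inr ⟨_, defect_mem_defectSet ha, _, defect_mem_defectSet hb, h0, h1, rfl⟩)

/-! ### Limit points and sequences -/

theorem Filter.Frequently.exists_lt_frequently {α : Type*} {f : Filter α} {N : ℕ}
    {p : ℕ → α → Prop} (h : ∃ᶠ a in f, ∃ n < N, p n a) : ∃ n < N, ∃ᶠ a in f, p n a := by
  by_contra! hc
  refine h ?_
  have := (Set.finite_lt_nat N).eventually_all (l := f) (p := fun n a => ¬ p n a) |>.2
    fun n hn => not_frequently.1 (by simpa using hc n hn)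
  filter_upwards [this] with a ha
  rintro ⟨n, hn, hp⟩
  exact ha n hn hp

theorem mem_derivedSet_of_tendsto {u : ℕ → ℝ} {x : ℝ} {S : Set ℝ} (hu : Tendsto u atTop (𝓝 x))
    (h : ∃ᶠ k in atTop, u k ≠ x ∧ u k ∈ S) : x ∈ derivedSet S :=
  accPt_iff_frequently.2 (hu.frequently h)

theorem exists_seq_of_mem_derivedSet {x : ℝ} {S : Set ℝ} (h : x ∈ derivedSet S) :
    ∃ u : ℕ → ℝ, Tendsto u atTop (𝓝 x) ∧ ∀ k, u k ≠ x ∧ u k ∈ S :=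
  exists_seq_forall_of_frequently (accPt_iff_frequently.1 h)

theorem nonneg_of_mem_closure {x : ℝ} (h : x ∈ closure defectSet) : 0 ≤ x := by
  refine closure_minimal ?_ isClosed_Ici h
  rintro _ ⟨n, hn, rfl⟩
  exact defect_nonneg hn

theorem tendsto_logb_one_add_div (b : ℝ) {a : ℕ → ℕ} (ha : Tendsto a atTop atTop) :
    Tendsto (fun k => 3 * Real.logb 3 (1 + b / a k)) atTop (𝓝 0) := by
  have h1 : Tendsto (fun k => 1 + b / (a k : ℝ)) atTop (𝓝 (1 + 0)) :=
    tendsto_const_nhds.add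
      (tendsto_const_nhds.div_atTop (tendsto_natCast_atTop_atTop.comp ha))
  rw [add_zero] at h1
  have h2 := ((Real.continuousAt_logb (b := 3) one_ne_zero).tendsto.comp h1).const_mul 3
  simpa using h2

/-! ### Stable numbers -/

theorem exists_defect_three_pow_mul_add {n : ℕ} (hn : 0 < n) (k : ℕ) :
    ∃ j : ℕ, defect (3 ^ k * n) + j = defect n := by
  induction k with
  | zero => exact ⟨0, by simp⟩
  | succ k ih =>
    obtain ⟨j, hj⟩ := ih
    obtain ⟨i, hi⟩ := exists_defect_mul_add (a := 3) (b := 3 ^ k * n) (by norm_num) (by positivity)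
    rw [defect_three] at hi
    refine ⟨i + j, ?_⟩
    rw [pow_succ', mul_assoc]
    push_cast
    linarith

/-- The defects of the stable numbers, which are those whose defect is unchanged by
multiplication by powers of `3`. -/
def stableDefectSet : Set ℝ :=
  {x | ∃ n : ℕ, 0 < n ∧ (∀ k, defect (3 ^ k * n) = defect n) ∧ defect n = x}

theorem stableDefectSet_subset : stableDefectSet ⊆ defectSet := by
  rintro _ ⟨n, hn, -, rfl⟩
  exact ⟨n, hn, rfl⟩

/-- Each failure of stability lowers the defect by at least 1, and defects are nonnegative. -/
theorem exists_stable_add {x : ℝ} (hx : x ∈ defectSet) :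
    ∃ s ∈ stableDefectSet, ∃ j : ℕ, s + j = x := by
  obtain ⟨n, hn, rfl⟩ := hx
  suffices h : ∀ N : ℕ, ∀ n, 0 < n → defect n < N →
      ∃ s ∈ stableDefectSet, ∃ j : ℕ, s + j = defect n by
    obtain ⟨N, hN⟩ := exists_nat_gt (defect n)
    exact h N n hn hN
  intro N
  induction N with
  | zero =>
    intro n hn h
    have := defect_nonneg hn
    rw [Nat.cast_zero] at h
    linarith
  | succ N ih =>
    intro n hn h
    by_cases hs : ∀ k, defect (3 ^ k * n) = defect n
    · exact ⟨_, ⟨n, hn, hs, rfl⟩, 0, by simp⟩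
    · push Not at hs
      obtain ⟨k, hk⟩ := hs
      obtain ⟨j, hj⟩ := exists_defect_three_pow_mul_add hn k
      have hj1 : 1 ≤ j := by
        by_contra h0
        obtain rfl : j = 0 := by omega
        exact hk (by simpa using hj)
      have hj1' : (1 : ℝ) ≤ j := by exact_mod_cast hj1
      push_cast at h
      obtain ⟨s, hs, i, hi⟩ := ih (3 ^ k * n) (by positivity) (by linarith)
      exact ⟨s, hs, i + j, by push_cast; linarith⟩

/-- Numbers whose defects differ by an integer differ by a power of `3`. -/
theorem three_pow_mul_eq_of_defect_add {m n j : ℕ} (hm : 0 < m) (hn : 0 < n)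
    (h : defect m + j = defect n) : ∃ a b : ℕ, 3 ^ a * m = 3 ^ b * n := by
  have hm' : (m : ℝ) ≠ 0 := by positivity
  have hn' : (n : ℝ) ≠ 0 := by positivity
  set p := integerComplexity n
  set q := integerComplexity m + j
  have hlog : Real.logb 3 ((m : ℝ) ^ 3 * 3 ^ p) = Real.logb 3 ((n : ℝ) ^ 3 * 3 ^ q) := by
    rw [Real.logb_mul (by positivity) (by positivity),
      Real.logb_mul (by positivity) (by positivity), Real.logb_pow, Real.logb_pow, Real.logb_pow,
      Real.logb_pow, Real.logb_self_eq_one (by norm_num)]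
    simp only [defect] at h
    simp only [p, q]
    push_cast
    linarith
  have heq : m ^ 3 * 3 ^ p = n ^ 3 * 3 ^ q := by
    have := Real.logb_injOn_pos (b := 3) (by norm_num) (Set.mem_Ioi.2 (by positivity))
      (Set.mem_Ioi.2 (by positivity)) hlog
    exact_mod_cast this
  have hp3 : Fact (Nat.Prime 3) := ⟨Nat.prime_three⟩
  -- Comparing 3-adic valuations shows that `p` and `q` agree modulo 3, so cube roots can be taken.
  have hval : 3 * padicValNat 3 m + p = 3 * padicValNat 3 n + q := by
    have := congrArg (padicValNat 3) heq
    rwa [padicValNat.mul (by positivity) (by positivity),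
      padicValNat.mul (by positivity) (by positivity), padicValNat.prime_pow,
      padicValNat.prime_pow, padicValNat.pow, padicValNat.pow] at this
  refine ⟨padicValNat 3 n, padicValNat 3 m, Nat.pow_left_injective (n := 3) (by norm_num) ?_⟩
  refine Nat.eq_of_mul_eq_mul_right (Nat.pow_pos (n := q) (by norm_num : 0 < 3)) ?_
  calc (3 ^ padicValNat 3 n * m) ^ 3 * 3 ^ q
      = m ^ 3 * 3 ^ (3 * padicValNat 3 n + q) := by ring
    _ = m ^ 3 * 3 ^ p * 3 ^ (3 * padicValNat 3 m) := by rw [← hval]; ring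
    _ = n ^ 3 * 3 ^ q * 3 ^ (3 * padicValNat 3 m) := by rw [heq]
    _ = (3 ^ padicValNat 3 m * n) ^ 3 * 3 ^ q := by ring

theorem eq_zero_of_stable {m n j : ℕ} (hm : 0 < m) (hn : 0 < n)
    (hs : ∀ k, defect (3 ^ k * n) = defect n) (h : defect m + j = defect n) : j = 0 := by
  obtain ⟨a, b, hab⟩ := three_pow_mul_eq_of_defect_add hm hn h
  obtain ⟨i, hi⟩ := exists_defect_three_pow_mul_add hm a
  rw [hab, hs] at hi
  have : (i : ℝ) + j = 0 := by linarith
  have : i + j = 0 := by exact_mod_cast this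
  omega

/-! ### From descent to translation by one and addition -/

/-- Every limit point of the set of defects below `K` exceeds by `1` a limit of defects. -/
def LimitDescent (K : ℝ) : Prop :=
  ∀ x < K, x ∈ derivedSet defectSet → x - 1 ∈ closure defectSet

theorem LimitDescent.exists_sub_mem {K : ℝ} (H : LimitDescent K) {y : ℝ}
    (hy : y ∈ closure defectSet) (hK : y < K) : ∃ i : ℕ, y - i ∈ defectSet := by
  obtain ⟨N, hN⟩ := exists_nat_gt y
  induction N generalizing y with
  | zero =>
    have := nonneg_of_mem_closure hy
    rw [Nat.cast_zero] at hN
    linarith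
  | succ N ih =>
    rw [closure_eq_self_union_derivedSet] at hy
    rcases hy with hy | hy
    · exact ⟨0, by simpa using hy⟩
    · push_cast at hN
      obtain ⟨i, hi⟩ := ih (H y hK hy) (by linarith) (by linarith)
      exact ⟨i + 1, by rw [Nat.cast_add, Nat.cast_one, add_comm, ← sub_sub]; exact hi⟩

theorem LimitDescent.stable_add_one_mem {K : ℝ} (H : LimitDescent K) {t : ℝ}
    (ht : t ∈ stableDefectSet) (hK : t < K) : t + 1 ∈ derivedSet stableDefectSet := by
  obtain ⟨n, hn, hs, rfl⟩ := ht
  set ε : ℕ → ℝ := fun k => 3 * Real.logb 3 (1 + 1 / ((3 ^ k * n : ℕ) : ℝ)) 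
  have hεlim : Tendsto ε atTop (𝓝 0) := by
    refine tendsto_logb_one_add_div 1 (a := fun k => 3 ^ k * n) ?_
    exact tendsto_atTop_mono (fun k => Nat.le_mul_of_pos_right _ hn)
      (tendsto_pow_atTop_atTop_of_one_lt (by norm_num))
  have hεpos : ∀ k, 0 < ε k := fun k => by
    have : (0 : ℝ) < 1 / ((3 ^ k * n : ℕ) : ℝ) := by positivity
    exact mul_pos (by norm_num) (Real.logb_pos (by norm_num) (by linarith))
  have hstep : ∀ k, ∃ J : ℕ, defect n + 1 - ε k - J ∈ stableDefectSet := fun k => by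
    obtain ⟨j, hj⟩ := exists_defect_add_one (a := 3 ^ k * n) (by positivity)
    obtain ⟨s, hs', i, hi⟩ := exists_stable_add (defect_mem_defectSet (Nat.succ_pos (3 ^ k * n)))
    refine ⟨i + j, ?_⟩
    convert! hs' using 1
    rw [hs k] at hj
    have hεk : ε k = 3 * Real.logb 3 (1 + 1 / ((3 ^ k * n : ℕ) : ℝ)) := rfl
    rw [← hεk] at hj
    rw [Nat.succ_eq_add_one] at hi
    push_cast
    linarith
  obtain ⟨N, hN⟩ := exists_nat_gt (defect n + 1)
  have hfreq : ∃ᶠ k in atTop, ∃ J < N, defect n + 1 - ε k - J ∈ stableDefectSet := by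
    refine Frequently.of_forall fun k => ?_
    obtain ⟨J, hJ⟩ := hstep k
    refine ⟨J, ?_, hJ⟩
    have h0 := nonneg_of_mem_closure (subset_closure (stableDefectSet_subset hJ))
    have := hεpos k
    have : (J : ℝ) < N := by linarith
    exact_mod_cast this
  obtain ⟨J, -, hJ⟩ := hfreq.exists_lt_frequently
  have hmem : defect n + 1 - J ∈ derivedSet stableDefectSet := by
    refine mem_derivedSet_of_tendsto (u := fun k => defect n + 1 - ε k - J) ?_ ?_
    · simpa using (hεlim.const_sub (defect n + 1)).sub_const (J : ℝ)
    · refine hJ.mono fun k hk => ⟨?_, hk⟩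
      have := hεpos k
      exact ne_of_lt (by linarith)
  rcases Nat.eq_zero_or_pos J with rfl | hJpos
  · simpa using hmem
  -- For `J ≥ 1` the limit is at most `defect n < K`, so descent applies and yields a defect `J + i`
  -- below that of the stable `n`.
  · have hJ1 : (1 : ℝ) ≤ J := by exact_mod_cast hJpos
    have h1 := H _ (by linarith) (derivedSet_mono _ _ stableDefectSet_subset hmem)
    obtain ⟨i, m, hm, hi⟩ := H.exists_sub_mem h1 (by linarith)
    have := eq_zero_of_stable (j := J + i) hm hn hs (by push_cast; linarith)
    omega

theorem add_one_mem_of_mem_closure {K : ℝ} {S : Set ℝ}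
    (hS : ∀ t ∈ S, t < K → t + 1 ∈ derivedSet stableDefectSet) {x : ℝ}
    (hx : x ∈ closure S) (hK : x < K) : x + 1 ∈ derivedSet stableDefectSet := by
  have hmem : x ∈ closure (Set.Iio K ∩ S) := isOpen_Iio.inter_closure ⟨hK, hx⟩
  have himage := image_closure_subset_closure_image (f := fun y : ℝ => y + 1) (by fun_prop)
    (Set.mem_image_of_mem _ hmem)
  refine closure_minimal ?_ (isClosed_derivedSet stableDefectSet) himage
  rintro _ ⟨t, ⟨htK, ht⟩, rfl⟩
  exact hS t ht htK

theorem LimitDescent.add_one_mem {K : ℝ} (H : LimitDescent K) {x : ℝ}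
    (hx : x ∈ closure defectSet) (hK : x < K) : x + 1 ∈ derivedSet stableDefectSet := by
  refine add_one_mem_of_mem_closure (fun y hy hyK => ?_) hx hK
  obtain ⟨s, hs, j, rfl⟩ := exists_stable_add hy
  have key : ∀ z ∈ closure stableDefectSet, z < K → z + 1 ∈ derivedSet stableDefectSet :=
    fun z hz hzK => add_one_mem_of_mem_closure (fun t => H.stable_add_one_mem) hz hzK
  clear hy
  induction j with
  | zero => exact H.stable_add_one_mem (by simpa using hs) (by simpa using hyK)
  | succ j ih =>
    push_cast at hyK ⊢
    rw [← add_assoc] at hyK ⊢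
    exact key _ (derivedSet_subset_closure _ (ih (by linarith))) hyK

theorem LimitDescent.add_one_mem_closure {K : ℝ} (H : LimitDescent K) {x : ℝ}
    (hx : x ∈ closure defectSet) (hK : x < K) : x + 1 ∈ closure defectSet :=
  closure_mono stableDefectSet_subset (derivedSet_subset_closure _ (H.add_one_mem hx hK))

theorem LimitDescent.add_nat_mem_closure {K : ℝ} (H : LimitDescent K) {x : ℝ} (j : ℕ)
    (hx : x ∈ closure defectSet) (hK : x + j < K + 1) : x + j ∈ closure defectSet := by
  induction j with
  | zero => simpa using hx
  | succ j ih =>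
    push_cast at hK ⊢
    rw [← add_assoc] at hK ⊢
    exact H.add_one_mem_closure (ih (by linarith)) (by linarith)

/-- `defect a + defect b` is `defect (a * b)` plus a natural number, and the closure admits steps of
1 from points below `K`. -/
theorem LimitDescent.add_mem_closure {K : ℝ} (H : LimitDescent K) {x y : ℝ}
    (hx : x ∈ closure defectSet) (hy : y ∈ closure defectSet) (hK : x + y < K) :
    x + y ∈ closure defectSet := by
  have hmem : (x, y) ∈ closure ({p : ℝ × ℝ | p.1 + p.2 < K} ∩ defectSet ×ˢ defectSet) := by
    refine (isOpen_lt (by fun_prop) (by fun_prop)).inter_closure ⟨hK, ?_⟩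
    rw [closure_prod_eq]
    exact ⟨hx, hy⟩
  have himage := image_closure_subset_closure_image (f := fun p : ℝ × ℝ => p.1 + p.2)
    (by fun_prop) (Set.mem_image_of_mem _ hmem)
  refine closure_minimal ?_ isClosed_closure himage
  rintro _ ⟨⟨_, _⟩, ⟨hlt, ⟨a, ha, rfl⟩, ⟨b, hb, rfl⟩⟩, rfl⟩
  obtain ⟨j, hj⟩ := exists_defect_mul_add ha hb
  have hlt' : defect a + defect b < K := hlt
  simp only [← hj] at hlt' ⊢
  exact H.add_nat_mem_closure j
    (subset_closure (defect_mem_defectSet (Nat.mul_pos ha hb))) (by linarith)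

/-! ### Limit points of sums and products, and the induction -/

theorem exists_of_mem_derivedSet_sumDefectSet {x : ℝ} (hx : x ∈ derivedSet sumDefectSet) :
    ∃ c : ℕ, 0 < c ∧ x - c ∈ closure defectSet := by
  -- Near `x` the defect is below `x + 1`, and `3 log₃ (1 + b/a) ≤ 3 log₃ 2 < 2`, so ‖b‖ < x + 3.
  obtain ⟨N, hN⟩ := exists_nat_gt (x + 3)
  have hfreq : ∃ᶠ y in 𝓝 x, ∃ b < 3 ^ N, 0 < b ∧ y ≠ x ∧ ∃ a : ℕ, b ≤ a ∧
      integerComplexity (a + b) = integerComplexity a + integerComplexity b ∧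
      defect (a + b) = y := by
    refine ((accPt_iff_frequently.1 hx).and_eventually (gt_mem_nhds (lt_add_one x))).mono ?_
    rintro y ⟨⟨hne, a, b, hb, hba, h, rfl⟩, hlt⟩
    refine ⟨b, ?_, hb, hne, a, hba, h, rfl⟩
    have ha := hb.trans_le hba
    have h1 := defect_add_of_eq ha h
    have h2 := logb_one_add_div_le ha hba
    have h3 := defect_nonneg ha
    have h4 := defectGap_pos
    rw [defectGap] at h4
    have h5 : (integerComplexity b : ℝ) < N := by linarith
    have h6 : integerComplexity b < N := by exact_mod_cast h5
    calc b ≤ b ^ 3 := Nat.le_self_pow (by norm_num) b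
      _ ≤ 3 ^ integerComplexity b := cube_le_three_pow_integerComplexity hb
      _ < 3 ^ N := Nat.pow_lt_pow_right (by norm_num) h6
  obtain ⟨b, -, hb⟩ := hfreq.exists_lt_frequently
  obtain ⟨u, hu, hub⟩ := exists_seq_forall_of_frequently hb
  have hbpos : 0 < b := (hub 0).1
  refine ⟨integerComplexity b, integerComplexity_pos hbpos, ?_⟩
  choose a hba hcomp hdef using fun k => (hub k).2.2
  -- With `b` fixed, bounded `a` gives finitely many values, and values other than `x` cannot then
  -- approach `x`.
  have ha : Tendsto a atTop atTop := by
    refine tendsto_atTop.2 fun M => ?_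
    have hfin : (((fun a => defect (a + b)) '' Set.Iio M) \ {x}).Finite :=
      ((Set.finite_Iio M).image _).sdiff
    filter_upwards [hu (hfin.isClosed.isOpen_compl.mem_nhds (by simp))] with k hk
    by_contra hlt
    exact hk ⟨⟨a k, not_le.1 hlt, hdef k⟩, (hub k).2.1⟩
  have hlim : Tendsto (fun k => defect (a k)) atTop (𝓝 (x - integerComplexity b)) := by
    have h := (hu.sub_const (integerComplexity b : ℝ)).add (tendsto_logb_one_add_div b ha)
    rw [add_zero] at h
    refine h.congr fun k => ?_
    rw [← hdef k, defect_add_of_eq (hbpos.trans_le (hba k)) (hcomp k)]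
    ring
  exact mem_closure_of_tendsto hlim
    (Eventually.of_forall fun k => defect_mem_defectSet (hbpos.trans_le (hba k)))

/-- By compactness both summands converge along a subsequence; they cannot both be eventually equal
to their limits. -/
theorem exists_of_mem_derivedSet_productDefectSet {x : ℝ} (hx : x ∈ derivedSet productDefectSet) :
    ∃ α ∈ derivedSet defectSet, ∃ β ∈ closure defectSet, defectGap ≤ β ∧ α + β = x := by
  obtain ⟨w, hw, hwm⟩ := exists_seq_of_mem_derivedSet hx
  choose hne u hu v hv hgu hgv huv using hwm
  have hnn := defectGap_pos
  have hbdd : ∃ᶠ k in atTop, (u k, v k) ∈ Set.Icc (0 : ℝ) (x + 1) ×ˢ Set.Icc (0 : ℝ) (x + 1) := by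
    refine Eventually.frequently ?_
    filter_upwards [hw.eventually (gt_mem_nhds (lt_add_one x))] with k hk
    have := hgu k
    have := hgv k
    have := huv k
    exact ⟨⟨by simp only; linarith, by simp only; linarith⟩,
      ⟨by simp only; linarith, by simp only; linarith⟩⟩
  obtain ⟨⟨α, β⟩, -, φ, hφ, hlim⟩ :=
    (isCompact_Icc.prod isCompact_Icc).tendsto_subseq' hbdd
  have hα : Tendsto (fun k => u (φ k)) atTop (𝓝 α) := (continuous_fst.tendsto _).comp hlim
  have hβ : Tendsto (fun k => v (φ k)) atTop (𝓝 β) := (continuous_snd.tendsto _).comp hlim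
  have hsum : α + β = x := by
    refine tendsto_nhds_unique (hα.add hβ) ?_
    simp only [huv]
    exact hw.comp hφ.tendsto_atTop
  by_cases hf : ∃ᶠ k in atTop, u (φ k) ≠ α
  · exact ⟨α, mem_derivedSet_of_tendsto hα (hf.mono fun k hk => ⟨hk, hu _⟩), β,
      mem_closure_of_tendsto hβ (Eventually.of_forall fun k => hv _),
      ge_of_tendsto' hβ fun k => hgv _, hsum⟩
  · rw [not_frequently] at hf
    refine ⟨β, mem_derivedSet_of_tendsto hβ (Eventually.frequently ?_), α,
      mem_closure_of_tendsto hα (Eventually.of_forall fun k => hu _),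
      ge_of_tendsto' hα fun k => hgu _, by rw [add_comm, hsum]⟩
    filter_upwards [hf] with k hk
    refine ⟨fun h => hne (φ k) ?_, hv _⟩
    rw [← huv, not_not.1 hk, h, hsum]

theorem LimitDescent.add_gap {K : ℝ} (H : LimitDescent K) : LimitDescent (K + defectGap) := by
  intro x hxK hx
  have hgap := defectGap_le_one
  have hx' := derivedSet_mono _ _ defectSet_subset hx
  rw [derivedSet_union, derivedSet_union] at hx'
  rcases hx' with hx' | hx' | hx'
  · have hfin : (({0, 1} : Set ℝ) \ {x}).Finite := (by simp : ({0, 1} : Set ℝ).Finite).sdiff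
    obtain ⟨y, ⟨hne, hy⟩, hy'⟩ := ((accPt_iff_frequently.1 hx').and_eventually
      (hfin.isClosed.isOpen_compl.mem_nhds (by simp))).exists
    exact absurd ⟨hy, hne⟩ hy'
  · obtain ⟨c, hc, hmem⟩ := exists_of_mem_derivedSet_sumDefectSet hx'
    obtain ⟨d, rfl⟩ := Nat.exists_eq_add_of_le' hc
    push_cast at hmem
    have := H.add_nat_mem_closure d hmem (by linarith)
    convert! this using 1
    ring
  · obtain ⟨α, hα, β, hβ, hgβ, rfl⟩ := exists_of_mem_derivedSet_productDefectSet hx'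
    -- `β ≥ defectGap` forces `α < K`, and `defectGap ≤ 1` keeps `α - 1 + β` below `K`.
    have h1 := H α (by linarith) hα
    convert! H.add_mem_closure h1 hβ (by linarith) using 1
    ring

theorem limitDescent (K : ℝ) : LimitDescent K := by
  have h (N : ℕ) : LimitDescent (N * defectGap) := by
    induction N with
    | zero =>
      intro x hx hmem
      have := nonneg_of_mem_closure (derivedSet_subset_closure _ hmem)
      rw [Nat.cast_zero, zero_mul] at hx
      linarith
    | succ N ih =>
      have := ih.add_gap
      rwa [Nat.cast_succ, add_one_mul]
  obtain ⟨N, hN⟩ := exists_nat_gt (K / defectGap)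
  exact fun x hx => h N x (hx.trans ((div_lt_iff₀ defectGap_pos).1 hN))

theorem mainTheorem4 :
    derivedSet (closure defectSet) = (fun x : ℝ => x + 1) '' closure defectSet := by
  rw [derivedSet_closure]
  refine Set.Subset.antisymm
    (fun x hx => ⟨x - 1, limitDescent (x + 1) x (lt_add_one x) hx, by simp⟩) ?_
  rintro _ ⟨x, hx, rfl⟩
  exact derivedSet_mono _ _ stableDefectSet_subset
    ((limitDescent (x + 1)).add_one_mem hx (lt_add_one x))
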